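/- Let $A=(a_{i,j})_{i,j\in I}$ be a Kac-Moody matrix (generalized Cartan matrix) with finite index set $I$: an integer matrix with $a_{i,i}=2$, $a_{i,j}\le 0$ for $i\ne j$, and $a_{i,j}=0\iff a_{j,i}=0$. Let $X,Y$ be free $\mathbb Z$-modules of finite rank in perfect duality, and let $\alpha_i\in X$ (simple roots) and $\alpha_i^\vee\in Y$ (simple coroots), $i\in I$, be such that $a_{i,j}=\alpha_j(\alpha_i^\vee)$; assume that the family $(\alpha_i)_{i\in I}$ is linearly independent in $X$ and that $(\alpha_i^\vee)_{i\in I}$ is linearly independent in $Y$. Put $V=Y\otimes_{\mathbb Z}\mathbb R$, and let $W^v\subset GL(V)$ be the group generated by the reflections $r_i(v)=v-\alpha_i(v)\alpha_i^\vee$, $i\in I$. The real roots are the $\beta=w(\alpha_i)\in X$ with $w\in W^v$, $i\in I$, and $r_\beta=w r_i w^{-1}$ is the corresponding reflection; $\beta$ is positive if $\beta\in\sum_{i}\mathbb N\alpha_i$. Let $Y^+=\{\lambda\in Y\mid \alpha_i(\lambda)\ge 0\ \ \forall i\in I\}$. For $\lambda\in Y^+$, a Hecke path of shape $\lambda$ is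 a continuous piecewise linear path $\pi:[0,1]\to V$, all of whose tangent vectors lie in the orbit $W^v\lambda$, such that for every $t\in(0,1)$ there are an integer $s\ge 0$, vectors $\xi_0,\xi_1,\dots,\xi_s\in V$ and positive real roots $\beta_1,\dots,\beta_s$ such that $\xi_0=\pi'_-(t)$ (left derivative), $\xi_s=\pi'_+(t)$ (right derivative) and, for all $i=1,\dots,s$, $$r_{\beta_i}(\xi_{i-1})=\xi_i,\qquad \beta_i(\xi_{i-1})<0,\qquad \beta_i(\pi(t))\in\mathbb Z.$$ Then for all $y_0,y_1\in Y$ and $\lambda\in Y^+$, the number of Hecke paths $\pi$ of shape $\lambda$ with $\pi(0)=y_0$ and $\pi(1)=y_1$ is finite (possibly zero). -/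

import Mathlib

open scoped TensorProduct

/-- A root generating system indexed by `I`: a Kac-Moody (generalized Cartan) matrix, two free
`ℤ`-modules of finite rank in duality, and simple roots and coroots realizing the matrix. -/
structure RootGeneratingSystem (I X Y : Type*) [AddCommGroup X] [Module.Free ℤ X]
    [Module.Finite ℤ X] [AddCommGroup Y] [Module.Free ℤ Y] [Module.Finite ℤ Y] where
  /-- The Kac-Moody matrix. -/
  cartan : Matrix I I ℤ
  cartan_diag : ∀ i, cartan i i = 2
  cartan_nonpos : ∀ i j, i ≠ j → cartan i j ≤ 0
  cartan_zero_iff : ∀ i j, cartan i j = 0 ↔ cartan j i = 0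
  /-- The duality between characters and cocharacters. -/
  pairing : X →ₗ[ℤ] Y →ₗ[ℤ] ℤ
  perfect : pairing.IsPerfPair
  simpleRoot : I → X
  simpleCoroot : I → Y
  compat : ∀ i j, cartan i j = pairing (simpleRoot j) (simpleCoroot i)

/-- The real vector space `V = Y ⊗ ℝ`, which is also the affine apartment. -/
abbrev Apartment (Y : Type*) [AddCommGroup Y] : Type _ := ℝ ⊗[ℤ] Y

/-- The image in `V` of a cocharacter. -/
def Apartment.ofCochar {Y : Type*} [AddCommGroup Y] (y : Y) : Apartment Y := (1 : ℝ) ⊗ₜ[ℤ] y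

/-- `π` has left derivative `ξ` at `t`, in the form suitable for piecewise linear paths:
`π` is affine with velocity `ξ` on a left neighbourhood of `t`. -/
def HasLeftVelocity {V : Type*} [AddCommGroup V] [Module ℝ V]
    (π : Set.Icc (0 : ℝ) 1 → V) (t : Set.Icc (0 : ℝ) 1) (ξ : V) : Prop :=
  ∃ ε : ℝ, 0 < ε ∧ ∀ s : Set.Icc (0 : ℝ) 1, (t : ℝ) - ε < s → (s : ℝ) ≤ t →
    π s = π t + ((s : ℝ) - t) • ξ

/-- `π` has right derivative `ξ` at `t`, in the form suitable for piecewise linear paths: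
`π` is affine with velocity `ξ` on a right neighbourhood of `t`. -/
def HasRightVelocity {V : Type*} [AddCommGroup V] [Module ℝ V]
    (π : Set.Icc (0 : ℝ) 1 → V) (t : Set.Icc (0 : ℝ) 1) (ξ : V) : Prop :=
  ∃ ε : ℝ, 0 < ε ∧ ∀ s : Set.Icc (0 : ℝ) 1, (t : ℝ) ≤ s → (s : ℝ) < t + ε →
    π s = π t + ((s : ℝ) - t) • ξ

namespace RootGeneratingSystem

variable {I X Y : Type*} [AddCommGroup X] [Module.Free ℤ X] [Module.Finite ℤ X]
  [AddCommGroup Y] [Module.Free ℤ Y] [Module.Finite ℤ Y] (S : RootGeneratingSystem I X Y)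

/-- The freedom condition: the simple roots are linearly independent in `X` and the simple
coroots are linearly independent in `Y`. -/
def IsFree : Prop :=
  LinearIndependent ℤ S.simpleRoot ∧ LinearIndependent ℤ S.simpleCoroot

/-- The real linear form on `V` defined by a character. -/
noncomputable def form (χ : X) : Module.Dual ℝ (Apartment Y) :=
  Module.Dual.baseChange ℝ (S.pairing χ)

theorem form_simpleRoot_simpleCoroot (i : I) :
    S.form (S.simpleRoot i) (Apartment.ofCochar (S.simpleCoroot i)) = 2 := by
  have h : S.pairing (S.simpleRoot i) (S.simpleCoroot i) = 2 := by
    rw [← S.compat, S.cartan_diag]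
  simp [form, Apartment.ofCochar, Module.Dual.baseChange_apply_tmul, h]

/-- The simple reflection `v ↦ v - αᵢ(v) αᵢ^∨` of `V`. -/
noncomputable def simpleReflection (i : I) : Apartment Y ≃ₗ[ℝ] Apartment Y :=
  Module.reflection (S.form_simpleRoot_simpleCoroot i)

/-- The vectorial Weyl group `W^v ⊂ GL(V)`. -/
def weylGroup : Subgroup (Apartment Y ≃ₗ[ℝ] Apartment Y) :=
  Subgroup.closure (Set.range S.simpleReflection)

/-- `β = w(αᵢ)` as linear forms on `V`, where `w` acts on forms by `w(α) = α ∘ w⁻¹`. -/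
def IsTransform (w : Apartment Y ≃ₗ[ℝ] Apartment Y) (i : I) (β : X) : Prop :=
  ∀ v, S.form β (w v) = S.form (S.simpleRoot i) v

/-- The real roots: the transforms of the simple roots under the Weyl group. -/
def realRoots : Set X :=
  {β | ∃ w ∈ S.weylGroup, ∃ i, S.IsTransform w i β}

/-- The positive real roots: those in the monoid generated by the simple roots. -/
def posRealRoots : Set X :=
  {β | β ∈ S.realRoots ∧ β ∈ AddSubmonoid.closure (Set.range S.simpleRoot)}

/-- `r` is the reflection `r_β = w rᵢ w⁻¹` of the real root `β = w(αᵢ)`. -/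
def IsReflectionOf (β : X) (r : Apartment Y ≃ₗ[ℝ] Apartment Y) : Prop :=
  ∃ w ∈ S.weylGroup, ∃ i, S.IsTransform w i β ∧ r = w * S.simpleReflection i * w⁻¹

/-- The dominant coweights `Y⁺`. -/
def dominantCoweights : Set Y :=
  {y | ∀ i, 0 ≤ S.pairing (S.simpleRoot i) y}

/-- The orbit `W^v · v`. -/
def weylOrbit (v : Apartment Y) : Set (Apartment Y) :=
  {u | ∃ w ∈ S.weylGroup, u = w v}

/-- `π` is a `v`-path: for some subdivision `0 = a₀ < a₁ < ⋯ < aₙ = 1` it is affine on each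
`[aⱼ, aⱼ₊₁]`, with velocity in the orbit `W^v · v`. -/
def IsWeylPath (v : Apartment Y) (π : Set.Icc (0 : ℝ) 1 → Apartment Y) : Prop :=
  ∃ (n : ℕ) (a : Fin (n + 1) → Set.Icc (0 : ℝ) 1) (ξ : Fin n → Apartment Y),
    StrictMono a ∧ a 0 = 0 ∧ a (Fin.last n) = 1 ∧
    ∀ j : Fin n, ξ j ∈ S.weylOrbit v ∧
      ∀ t : Set.Icc (0 : ℝ) 1, a j.castSucc ≤ t → t ≤ a j.succ →
        π t = π (a j.castSucc) + ((t : ℝ) - a j.castSucc) • ξ j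

/-- One step `ξ ↦ ξ' = r_β(ξ)` of a `W^v_x`-chain: `β` is a positive real root with `β(ξ) < 0`
such that `x` lies in a wall of direction `Ker β`. -/
def ChainStep (x ξ ξ' : Apartment Y) : Prop :=
  ∃ β ∈ S.posRealRoots, (∃ r, S.IsReflectionOf β r ∧ r ξ = ξ') ∧
    S.form β ξ < 0 ∧ ∃ k : ℤ, S.form β x = k

/-- `π` is a Hecke path of shape `lam`: a `lam`-path such that at each `0 < t < 1` there is a
(possibly trivial) `W^v_{π(t)}`-chain from the left derivative to the right derivative. -/
def IsHeckePath (lam : Y) (π : Set.Icc (0 : ℝ) 1 → Apartment Y) : Prop :=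
  S.IsWeylPath (Apartment.ofCochar lam) π ∧
  ∀ t : Set.Icc (0 : ℝ) 1, 0 < t → t < 1 →
    ∃ ξ ξ' : Apartment Y, HasLeftVelocity π t ξ ∧ HasRightVelocity π t ξ' ∧
      Relation.ReflTransGen (S.ChainStep (π t)) ξ ξ'

end RootGeneratingSystem

/-! Read a Hecke path backwards from its final velocity `ξ = wλ`. Each step of a chain at time `τ`
replaces a velocity `η` by `r_β(η) = η - β(η)β^∨`. Undoing the later foldings gives `π(s) = y₀ -
h(0) + sξ + h(s)`, where `h(s)` is the sum of the terms `(τ - s)⁺(r_β(η) - η)`. The wall condition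
makes `τβ(η)` a negative integer, because `y₀ - h(0)` is integral; hence each fold contributes to
`h(0)` a positive integer multiple of a positive coroot.

At `s = 1` this reads `λ - (y₁ - y₀) = (λ - wλ) + h(0)`. Both summands are sums of simple coroots
(`sub_mem_corootCone`, `FoldTrace.apply_zero_mem`), so their heights are bounded by the endpoints.
This leaves finitely many `ξ`. For fixed `ξ` and bounded height of `h(0)`, `finite_foldTrace`
removes the last fold: there are finitely many choices of its coroot and of its contribution, and
these determine the root (`IsRootPair.unique`) and the time. The height of what remains has dropped
by at least 1.

The Coxeter input is that a real root and its coroot have the same sign and that `λ - wλ ≥ 0`. Both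
follow from one positivity statement for reduced words, proved by reduction to rank two and applied
to `V` and to its dual. -/

section ReducedWords

/-! ### Reduced words in a group generated by involutions. -/

variable {G ι : Type*} [Group G]

/-- The product in a group of a word in a family of elements. -/
def wordProd (s : ι → G) (l : List ι) : G := (l.map s).prod

@[simp] theorem wordProd_nil (s : ι → G) : wordProd s [] = 1 := rfl

@[simp] theorem wordProd_cons (s : ι → G) (i : ι) (l : List ι) :
    wordProd s (i :: l) = s i * wordProd s l := by simp [wordProd]

@[simp] theorem wordProd_append (s : ι → G) (l l' : List ι) :
    wordProd s (l ++ l') = wordProd s l * wordProd s l' := by simp [wordProd]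

/-- A word is reduced if no shorter word has the same product. -/
def IsReducedWord (s : ι → G) (l : List ι) : Prop :=
  ∀ l', wordProd s l' = wordProd s l → l.length ≤ l'.length

theorem IsReducedWord.of_append_left {s : ι → G} {l l' : List ι}
    (h : IsReducedWord s (l ++ l')) : IsReducedWord s l := by
  intro m hm
  have := h (m ++ l') (by simp [hm])
  simpa using this

theorem IsReducedWord.of_append_right {s : ι → G} {l l' : List ι}
    (h : IsReducedWord s (l ++ l')) : IsReducedWord s l' := by
  intro m hm
  have := h (l ++ m) (by simp [hm])
  simpa using this

theorem exists_isReducedWord (s : ι → G) (l : List ι) :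
    ∃ l', IsReducedWord s l' ∧ wordProd s l' = wordProd s l ∧ l'.length ≤ l.length := by
  classical
  have hex : ∃ n, ∃ l', wordProd s l' = wordProd s l ∧ l'.length = n := ⟨_, l, rfl, rfl⟩
  obtain ⟨l', h1, h2⟩ := Nat.find_spec hex
  refine ⟨l', fun m hm => ?_, h1, ?_⟩
  · rw [h2]
    exact Nat.find_min' hex ⟨m, hm.trans h1, rfl⟩
  · rw [h2]
    exact Nat.find_min' hex ⟨l, rfl, rfl⟩

/-- The alternating word `⋯ t s t` of given length in two letters, ending in `t`. -/
def altWord (s t : ι) : ℕ → List ι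
  | 0 => []
  | k + 1 => altWord t s k ++ [t]

@[simp] theorem altWord_zero (s t : ι) : altWord s t 0 = [] := by rw [altWord]

theorem altWord_succ (s t : ι) (k : ℕ) : altWord s t (k + 1) = altWord t s k ++ [t] := by
  rw [altWord]

@[simp] theorem length_altWord (k : ℕ) : ∀ s t : ι, (altWord s t k).length = k := by
  induction k with
  | zero => simp
  | succ k ih => intro s t; simp [altWord_succ, ih]

theorem altWord_succ_left (k : ℕ) : ∀ s t : ι,
    altWord s t (k + 1) = (if Even k then t else s) :: altWord s t k := by
  induction k with
  | zero => intro s t; simp [altWord_succ]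
  | succ k ih =>
    intro s t
    rw [altWord_succ, ih t s, altWord_succ s t k]
    by_cases hk : Even k <;> simp [hk, Nat.even_add_one]

theorem altWord_suffix (s t : ι) (k n : ℕ) (h : k ≤ n) :
    ∃ l, altWord s t n = l ++ altWord s t k := by
  induction n, h using Nat.le_induction with
  | base => exact ⟨[], rfl⟩
  | succ n _ ih =>
    obtain ⟨l, hl⟩ := ih
    rw [altWord_succ_left, hl]
    exact ⟨_ :: l, rfl⟩

variable {s : ι → G} (hs : ∀ i, s i * s i = 1)

-- Two equal adjacent letters would cancel, so a reduced word in two letters alternates.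
include hs in
theorem IsReducedWord.eq_altWord (l : List ι) :
    ∀ i j : ι, (∀ x ∈ l, x = i ∨ x = j) → IsReducedWord s (l ++ [i]) →
      l = altWord i j l.length := by
  induction l using List.reverseRecOn with
  | nil => simp
  | append_singleton l x ih =>
    intro i j hx hred
    have hxi : x ≠ i := by
      rintro rfl
      have := hred l (by simp [hs])
      simp at this
    have hxj : x = j := (hx x (by simp)).resolve_left hxi
    subst hxj
    have := ih x i (fun y hy => (hx y (by simp [hy])).symm) hred.of_append_left
    simp only [List.length_append, List.length_singleton, altWord_succ]
    rw [← this]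

/-- The length of the braid relation between two simple reflections is encoded in the product
of the two off-diagonal coefficients of the Kac-Moody matrix. -/
def IsBraidLength (c : ℤ) (m : ℕ) : Prop :=
  (c = 0 ∧ m = 2) ∨ (c = 1 ∧ m = 3) ∨ (c = 2 ∧ m = 4) ∨ (c = 3 ∧ m = 6)

-- If `k ≥ m`, the braid relation turns the last `m` letters of the alternating word into a word
-- ending in `i`, which cancels against the final `i`.
include hs in
theorem IsReducedWord.lt_of_braid {i j : ι} {m k : ℕ} (hm : 0 < m)
    (hb : wordProd s (altWord i j m) = wordProd s (altWord j i m))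
    (hred : IsReducedWord s (altWord i j k ++ [i])) : k < m := by
  by_contra! hk
  obtain ⟨l, hl⟩ := altWord_suffix i j m k hk
  rw [hl, List.append_assoc] at hred
  obtain ⟨n, rfl⟩ : ∃ n, m = n + 1 := ⟨m - 1, by omega⟩
  have := hred.of_append_right (altWord i j n) (by
    rw [wordProd_append, hb, altWord_succ j i n]
    simp [mul_assoc, hs])
  simp at this

include hs in
theorem exists_wordProd_eq {g : G} (hg : g ∈ Subgroup.closure (Set.range s)) :
    ∃ l, wordProd s l = g := by
  induction hg using Subgroup.closure_induction with
  | mem x hx => obtain ⟨i, rfl⟩ := hx; exact ⟨[i], by simp⟩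
  | one => exact ⟨[], rfl⟩
  | mul x y _ _ hx hy =>
    obtain ⟨l, rfl⟩ := hx
    obtain ⟨l', rfl⟩ := hy
    exact ⟨l ++ l', by simp⟩
  | inv x hx' hx =>
    obtain ⟨l, rfl⟩ := hx
    clear hx'
    refine ⟨l.reverse, ?_⟩
    induction l with
    | nil => simp
    | cons i l ih =>
      have : (s i)⁻¹ = s i := inv_eq_of_mul_eq_one_left (hs i)
      simp [ih, this]

variable {ε : G →* ℝˣ} (hε : ∀ i, ε (s i) = -1)

include hε in
theorem map_wordProd_eq_neg_one_pow (l : List ι) : ε (wordProd s l) = (-1) ^ l.length := by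
  induction l with
  | nil => simp
  | cons i l ih => simp [ih, hε, pow_succ]

include hε in
theorem length_ne_of_wordProd_append_eq {l l' : List ι} {i : ι}
    (h : wordProd s l' = wordProd s (l ++ [i])) : l'.length ≠ l.length := by
  intro hl
  have h1 := congrArg ε h
  rw [map_wordProd_eq_neg_one_pow hε, map_wordProd_eq_neg_one_pow hε, hl, List.length_append,
    List.length_singleton, pow_succ] at h1
  have h2 := congrArg Units.val (left_eq_mul.1 h1)
  norm_num at h2

include hε in
/-- If `l ++ [i]` is not reduced, then the product of `l ++ [i]` has a word shorter
than `l`. -/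
theorem exists_shorter_of_not_isReducedWord {l : List ι} {i : ι}
    (h : ¬ IsReducedWord s (l ++ [i])) :
    ∃ l', wordProd s l' = wordProd s (l ++ [i]) ∧ l'.length < l.length := by
  rw [IsReducedWord] at h
  push Not at h
  obtain ⟨l', h1, h2⟩ := h
  have := length_ne_of_wordProd_append_eq hε h1
  simp at h2
  exact ⟨l', h1, by omega⟩

-- This dichotomy decides the sign of the root `g(αᵢ)`. If a reduced word of `g` followed by `i` is
-- not reduced, parity forces a word of `g sᵢ` shorter than that of `g`.
include hs hε in
theorem exists_isReducedWord_append {g : G} (hg : g ∈ Subgroup.closure (Set.range s)) (i : ι) :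
    ∃ l, IsReducedWord s (l ++ [i]) ∧ (g = wordProd s l ∨ g = wordProd s l * s i) := by
  obtain ⟨l₀, rfl⟩ := exists_wordProd_eq hs hg
  obtain ⟨l, hl, hp, -⟩ := exists_isReducedWord s l₀
  rw [← hp]
  by_cases h : IsReducedWord s (l ++ [i])
  · exact ⟨l, h, Or.inl rfl⟩
  · obtain ⟨l', h1, h2⟩ := exists_shorter_of_not_isReducedWord hε h
    have h3 : wordProd s (l' ++ [i]) = wordProd s l := by
      simp [h1, mul_assoc, hs]
    refine ⟨l', fun m hm => ?_, Or.inr ?_⟩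
    · have := hl m (hm.trans h3)
      simp
      omega
    · simpa using h3.symm

include hs hε in
/-- If `l ++ [j, i]` is reduced, then `l ++ [j]` can be rewritten as `v ++ d` with `d` alternating
in `i` and `j`, ending in `j`, and with `v ++ [i]`, `v ++ [j]` and `d ++ [i]` reduced. -/
theorem IsReducedWord.exists_dihedral_decomposition {l : List ι} {i j : ι}
    (h : IsReducedWord s (l ++ [j] ++ [i])) :
    ∃ (v : List ι) (k : ℕ), wordProd s (v ++ altWord i j k) = wordProd s (l ++ [j]) ∧
      v.length ≤ l.length ∧ IsReducedWord s (v ++ [i]) ∧ IsReducedWord s (v ++ [j]) ∧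
      IsReducedWord s (altWord i j k ++ [i]) := by
  classical
  -- Take the shortest possible `v`: were `v ++ [x]` not reduced for `x = i` or `x = j`, a letter
  -- `x` could be moved from `v` into `d`.
  let Q : ℕ → Prop := fun n => ∃ v d : List ι, (∀ x ∈ d, x = i ∨ x = j) ∧
    wordProd s (v ++ d) = wordProd s (l ++ [j]) ∧ v.length + d.length = l.length + 1 ∧
    v.length = n
  have hQ : Q l.length := ⟨l, [j], by simp, rfl, by simp, rfl⟩
  have hex : ∃ n, Q n := ⟨_, hQ⟩
  obtain ⟨v, d, hd, hp, hlen, hv⟩ := Nat.find_spec hex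
  have hvl : v.length ≤ l.length := hv ▸ Nat.find_min' hex hQ
  have hlj : IsReducedWord s (l ++ [j]) := h.of_append_left
  have key : ∀ x, x = i ∨ x = j → IsReducedWord s (v ++ [x]) := by
    intro x hx
    by_contra hnot
    obtain ⟨v', h1, h2⟩ := exists_shorter_of_not_isReducedWord hε hnot
    have h3 : wordProd s (v' ++ x :: d) = wordProd s (l ++ [j]) := by
      rw [← hp, wordProd_append, h1]
      simp only [wordProd_append, wordProd_cons, wordProd_nil, mul_one]
      rw [mul_assoc, ← mul_assoc (s x) (s x), hs, one_mul]
    have h4 := hlj _ h3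
    simp only [List.length_append, List.length_cons, List.length_nil] at h4
    have h5 : Q v'.length := by
      refine ⟨v', x :: d, ?_, h3, ?_, rfl⟩
      · intro y hy
        rcases List.mem_cons.1 hy with rfl | hy
        · exact hx
        · exact hd y hy
      · simp only [List.length_cons]
        omega
    have := Nat.find_min' hex h5
    omega
  have hred : IsReducedWord s (d ++ [i]) := by
    apply IsReducedWord.of_append_right (l := v)
    intro m hm
    have := h m (by
      rw [hm, ← List.append_assoc, wordProd_append, hp, ← wordProd_append])
    simp only [List.length_append, List.length_cons, List.length_nil] at this ⊢
    omega
  have hd' := IsReducedWord.eq_altWord hs d i j hd hred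
  refine ⟨v, d.length, ?_, hvl, key i (Or.inl rfl), key j (Or.inr rfl), ?_⟩
  · rw [← hd']; exact hp
  · rw [← hd']; exact hred

end ReducedWords

/-! ### Positivity of the images of simple roots under reduced words. -/

section Positivity

variable {G ι M : Type*} [Group G] [AddCommGroup M] [Module ℝ M]
  {s : ι → G} (hs : ∀ i, s i * s i = 1) {ε : G →* ℝˣ} (hε : ∀ i, ε (s i) = -1)
  {A : Matrix ι ι ℤ} (hA₂ : ∀ i, A i i = 2) (hAn : ∀ i j, i ≠ j → A i j ≤ 0)
  (hbraid : ∀ i j, i ≠ j → ∀ m, IsBraidLength (A i j * A j i) m →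
    wordProd s (altWord i j m) = wordProd s (altWord j i m))
  {ρ : G →* Module.End ℝ M} {a : ι → M} {f : ι → Module.Dual ℝ M}
  (hρ : ∀ i v, ρ (s i) v = v - f i v • a i) (hf : ∀ i j, f i (a j) = (A i j : ℝ))

include hA₂ hρ hf in
theorem map_simple_mem_step_right (i j : ι) (x y : ℤ) :
    ρ (s j) ((x : ℝ) • a i + ((-A j i * y : ℤ) : ℝ) • a j) =
      (x : ℝ) • a i + ((-A j i * (x - y) : ℤ) : ℝ) • a j := by
  simp only [hρ, map_add, map_smul, hf, hA₂, smul_eq_mul]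
  push_cast
  module

include hA₂ hρ hf in
theorem map_simple_mem_step_left (i j : ι) (x y : ℤ) :
    ρ (s i) ((x : ℝ) • a i + ((-A j i * y : ℤ) : ℝ) • a j) =
      ((A i j * A j i * y - x : ℤ) : ℝ) • a i + ((-A j i * y : ℤ) : ℝ) • a j := by
  simp only [hρ, map_add, map_smul, hf, hA₂, smul_eq_mul]
  push_cast
  module

-- In the coordinates `x aᵢ + (-A j i) y aⱼ` the two reflections act by `(x, y) ↦ (x, x - y)` and
-- `(x, y) ↦ (c y - x, y)`, which depend only on `c = A i j * A j i`. For `c ≥ 4` the inequalities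
-- `0 ≤ 2y ≤ x` persist after each pair of letters; for `c ≤ 3` the braid relation leaves only the
-- short words to inspect.
include hs hA₂ hAn hbraid hρ hf in
theorem exists_nonneg_coeff_altWord {i j : ι} (hij : i ≠ j) {k : ℕ}
    (hred : IsReducedWord s (altWord i j k ++ [i])) :
    ∃ x y : ℤ, 0 ≤ x ∧ 0 ≤ y ∧
      ρ (wordProd s (altWord i j k)) (a i) = (x : ℝ) • a i + (y : ℝ) • a j := by
  have hc0 : 0 ≤ A i j * A j i := mul_nonneg_of_nonpos_of_nonpos (hAn i j hij) (hAn j i hij.symm)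
  have hb0 : 0 ≤ -A j i := by have := hAn j i hij.symm; omega
  have e0 : ρ (wordProd s (altWord i j 0)) (a i) =
      ((1 : ℤ) : ℝ) • a i + ((-A j i * 0 : ℤ) : ℝ) • a j := by simp
  have step : ∀ k, ρ (wordProd s (altWord i j (k + 1))) (a i) =
      ρ (s (if Even k then j else i)) (ρ (wordProd s (altWord i j k)) (a i)) := by
    intro k
    rw [altWord_succ_left, wordProd_cons, map_mul]
    rfl
  have stepR := map_simple_mem_step_right hA₂ hρ hf i j
  have stepL := map_simple_mem_step_left hA₂ hρ hf i j
  suffices H : ∃ x y : ℤ, 0 ≤ x ∧ 0 ≤ -A j i * y ∧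
      ρ (wordProd s (altWord i j k)) (a i) = (x : ℝ) • a i + ((-A j i * y : ℤ) : ℝ) • a j by
    obtain ⟨x, y, h1, h2, h3⟩ := H
    exact ⟨x, _, h1, h2, h3⟩
  rcases le_or_gt 4 (A i j * A j i) with hc | hc
  · have inv : ∀ n, ∃ x y : ℤ, 0 ≤ y ∧ 2 * y ≤ x ∧ ρ (wordProd s (altWord i j (2 * n))) (a i) =
        (x : ℝ) • a i + ((-A j i * y : ℤ) : ℝ) • a j := by
      intro n
      induction n with
      | zero => exact ⟨1, 0, le_rfl, by norm_num, e0⟩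
      | succ n ih =>
        obtain ⟨x, y, hy, hxy, h⟩ := ih
        refine ⟨A i j * A j i * (x - y) - x, x - y, by omega, by nlinarith, ?_⟩
        · rw [show 2 * (n + 1) = 2 * n + 1 + 1 by ring, step, step, h]
          simp only [even_two, Even.mul_right, if_true, Nat.not_even_bit1, if_false]
          rw [stepR, stepL]
    obtain ⟨n, rfl | rfl⟩ := Nat.even_or_odd' k
    · obtain ⟨x, y, hy, hxy, h⟩ := inv n
      exact ⟨x, y, by omega, mul_nonneg hb0 hy, h⟩
    · obtain ⟨x, y, hy, hxy, h⟩ := inv n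
      refine ⟨x, x - y, by omega, mul_nonneg hb0 (by omega), ?_⟩
      rw [step, h]
      simp only [even_two, Even.mul_right, if_true]
      rw [stepR]
  · have e1 := step 0
    rw [e0] at e1
    simp only [Even.zero, if_true, stepR] at e1
    have e2 := step 1
    rw [e1] at e2
    simp only [Nat.not_even_one, if_false, stepL] at e2
    have e3 := step 2
    rw [e2] at e3
    simp only [even_two, if_true, stepR] at e3
    have e4 := step 3
    rw [e3] at e4
    simp only [show ¬ Even 3 by decide, if_false, stepL] at e4
    have e5 := step 4
    rw [e4] at e5
    simp only [show Even 4 by decide, if_true, stepR] at e5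
    have hlt : ∀ m, IsBraidLength (A i j * A j i) m → 0 < m → k < m := fun m hm h0 =>
      hred.lt_of_braid hs h0 (hbraid i j hij m hm)
    obtain hc' | hc' | hc' | hc' : A i j * A j i = 0 ∨ A i j * A j i = 1 ∨ A i j * A j i = 2 ∨
        A i j * A j i = 3 := by omega
    · have hk := hlt 2 (Or.inl ⟨hc', rfl⟩) (by norm_num)
      interval_cases k
      · exact ⟨_, _, by norm_num, mul_nonneg hb0 (by norm_num), e0⟩
      · exact ⟨_, _, by norm_num, mul_nonneg hb0 (by norm_num), e1⟩
    · have hk := hlt 3 (Or.inr (Or.inl ⟨hc', rfl⟩)) (by norm_num)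
      simp only [hc'] at e2
      interval_cases k
      · exact ⟨_, _, by norm_num, mul_nonneg hb0 (by norm_num), e0⟩
      · exact ⟨_, _, by norm_num, mul_nonneg hb0 (by norm_num), e1⟩
      · exact ⟨_, _, by norm_num, mul_nonneg hb0 (by norm_num), e2⟩
    · have hk := hlt 4 (Or.inr (Or.inr (Or.inl ⟨hc', rfl⟩))) (by norm_num)
      simp only [hc'] at e2 e3
      interval_cases k
      · exact ⟨_, _, by norm_num, mul_nonneg hb0 (by norm_num), e0⟩
      · exact ⟨_, _, by norm_num, mul_nonneg hb0 (by norm_num), e1⟩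
      · exact ⟨_, _, by norm_num, mul_nonneg hb0 (by norm_num), e2⟩
      · exact ⟨_, _, by norm_num, mul_nonneg hb0 (by norm_num), e3⟩
    · have hk := hlt 6 (Or.inr (Or.inr (Or.inr ⟨hc', rfl⟩))) (by norm_num)
      simp only [hc'] at e2 e3 e4 e5
      interval_cases k
      · exact ⟨_, _, by norm_num, mul_nonneg hb0 (by norm_num), e0⟩
      · exact ⟨_, _, by norm_num, mul_nonneg hb0 (by norm_num), e1⟩
      · exact ⟨_, _, by norm_num, mul_nonneg hb0 (by norm_num), e2⟩
      · exact ⟨_, _, by norm_num, mul_nonneg hb0 (by norm_num), e3⟩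
      · exact ⟨_, _, by norm_num, mul_nonneg hb0 (by norm_num), e4⟩
      · exact ⟨_, _, by norm_num, mul_nonneg hb0 (by norm_num), e5⟩

theorem intCast_smul_mem {P : AddSubmonoid M} {v : M} (hv : v ∈ P) {x : ℤ} (hx : 0 ≤ x) :
    (x : ℝ) • v ∈ P := by
  lift x to ℕ using hx
  rw [Int.cast_natCast, Nat.cast_smul_eq_nsmul]
  exact P.nsmul_mem hv x

include hs hε hA₂ hAn hbraid hρ hf in
/-- If `l ++ [i]` is reduced, the product of `l` maps the `i`-th simple root to a positive one. -/
theorem IsReducedWord.map_simple_mem (n : ℕ) : ∀ {l : List ι} {i : ι}, l.length ≤ n →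
    IsReducedWord s (l ++ [i]) →
    ρ (wordProd s l) (a i) ∈ AddSubmonoid.closure (Set.range a) := by
  induction n with
  | zero =>
    intro l i hl _
    rw [List.length_eq_zero_iff.1 (Nat.le_zero.1 hl)]
    simpa using AddSubmonoid.subset_closure (Set.mem_range_self i)
  | succ n ih =>
    intro l i hl h
    rcases List.eq_nil_or_concat' l with rfl | ⟨l, j, rfl⟩
    · simpa using AddSubmonoid.subset_closure (Set.mem_range_self i)
    have hij : i ≠ j := by
      rintro rfl
      have := h l (by simp [hs])
      simp at this
    -- The dihedral factor sends `aᵢ` to a nonnegative combination of `aᵢ` and `aⱼ`; the shorter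
    -- word `v` keeps both positive by induction.
    obtain ⟨v, k, hp, hvl, hvi, hvj, hk⟩ := h.exists_dihedral_decomposition hs hε
    obtain ⟨x, y, hx, hy, hxy⟩ :=
      exists_nonneg_coeff_altWord hs hA₂ hAn hbraid hρ hf hij hk
    simp only [List.length_append, List.length_singleton] at hl
    rw [← hp, wordProd_append, map_mul, Module.End.mul_apply, hxy, map_add, map_smul, map_smul]
    exact add_mem (intCast_smul_mem (ih (by omega) hvi) hx)
      (intCast_smul_mem (ih (by omega) hvj) hy)

-- Telescoping: appending a letter `i` to `l` adds `f i v ≥ 0` times the image of `a i` under `l`,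
-- which is positive.
include hs hε hA₂ hAn hbraid hρ hf in
theorem IsReducedWord.sub_map_mem {l : List ι} (h : IsReducedWord s l) {v : M}
    (hv : ∀ i, ∃ n : ℕ, f i v = n) :
    v - ρ (wordProd s l) v ∈ AddSubmonoid.closure (Set.range a) := by
  induction l using List.reverseRecOn with
  | nil => simp
  | append_singleton l i ih =>
    obtain ⟨n, hn⟩ := hv i
    have h1 := ih h.of_append_left
    have h2 := IsReducedWord.map_simple_mem hs hε hA₂ hAn hbraid hρ hf _ le_rfl h
    have : v - ρ (wordProd s (l ++ [i])) v =
        (v - ρ (wordProd s l) v) + n • ρ (wordProd s l) (a i) := by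
      simp only [wordProd_append, wordProd_cons, wordProd_nil, mul_one, map_mul,
        Module.End.mul_apply, hρ, hn, map_sub, map_nsmul, Nat.cast_smul_eq_nsmul]
      abel
    rw [this]
    exact add_mem h1 (nsmul_mem h2 n)

end Positivity

/-! ### Heights on the monoid generated by an independent family. -/

section Coordinates

variable {ι M : Type*} [AddCommGroup M] {a : ι → M}

/-- Independence over `ℤ` is independence over `ℚ`, so prescribed values extend to a `ℚ`-linear
functional. -/
theorem LinearIndependent.exists_height [Module ℝ M] (ha : LinearIndependent ℤ a) :
    ∃ ht : M →+ ℚ, ∀ i, ht (a i) = 1 := by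
  let : Module ℚ M := Module.compHom M (algebraMap ℚ ℝ)
  have h : LinearIndependent ℚ a := (LinearIndependent.iff_fractionRing ℤ ℚ).1 ha
  obtain ⟨g, hg⟩ := LinearMap.exists_leftInverse_of_injective _ (LinearMap.ker_eq_bot.2 h)
  refine ⟨((Finsupp.linearCombination ℚ fun _ : ι => (1 : ℚ)).comp g).toAddMonoidHom, fun i => ?_⟩
  have : g (a i) = Finsupp.single i 1 := by
    simpa using LinearMap.congr_fun hg (Finsupp.single i 1)
  simp [this]

theorem finite_height_le [Finite ι] {ht : M →+ ℚ} (h : ∀ i, ht (a i) = 1) (n : ℚ) :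
    {p | p ∈ AddSubmonoid.closure (Set.range a) ∧ ht p ≤ n}.Finite := by
  have := Fintype.ofFinite ι
  refine ((Set.Finite.pi' fun _ : ι => Set.finite_Iic ⌊n⌋₊).image fun c => ∑ i, c i • a i).subset ?_
  rintro p ⟨hp, hn⟩
  obtain ⟨c, rfl⟩ := AddSubmonoid.mem_closure_range_iff_of_fintype.1 hp
  refine ⟨c, fun i => Nat.le_floor ?_, rfl⟩
  refine le_trans ?_ hn
  simp only [map_sum, map_nsmul, h, nsmul_eq_mul, mul_one]
  exact Finset.single_le_sum (f := fun i => (c i : ℚ)) (fun _ _ => by positivity) (Finset.mem_univ i)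

theorem height_nonneg {ht : M →+ ℚ} (h : ∀ i, ht (a i) = 1) {p : M}
    (hp : p ∈ AddSubmonoid.closure (Set.range a)) : 0 ≤ ht p := by
  induction hp using AddSubmonoid.closure_induction with
  | mem x hx => obtain ⟨i, rfl⟩ := hx; simp [h]
  | zero => simp
  | add x y _ _ hx hy => rw [map_add]; positivity

theorem one_le_height {ht : M →+ ℚ} (h : ∀ i, ht (a i) = 1) {p : M}
    (hp : p ∈ AddSubmonoid.closure (Set.range a)) (h0 : p ≠ 0) : 1 ≤ ht p := by
  induction hp using AddSubmonoid.closure_induction with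
  | mem x hx => obtain ⟨i, rfl⟩ := hx; simp [h]
  | zero => exact absurd rfl h0
  | add x y hx' hy' hx hy =>
    rw [map_add]
    by_cases hx0 : x = 0
    · subst hx0
      simpa using hy (by simpa using h0)
    · have := hx hx0
      have := height_nonneg h hy'
      linarith

end Coordinates

section Contragredient

/-- The contragredient of the tautological representation of a linear group. -/
noncomputable def contragredient (V : Type*) [AddCommGroup V] [Module ℝ V] :
    (V ≃ₗ[ℝ] V) →* Module.End ℝ (Module.Dual ℝ V) where
  toFun g := Module.Dual.transpose (R := ℝ) (g⁻¹ : V ≃ₗ[ℝ] V).toLinearMap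
  map_one' := rfl
  map_mul' g h := by
    refine LinearMap.ext fun φ => LinearMap.ext fun v => ?_
    simp only [mul_inv_rev]
    rfl

@[simp] theorem contragredient_apply {V : Type*} [AddCommGroup V] [Module ℝ V] (g : V ≃ₗ[ℝ] V)
    (φ : Module.Dual ℝ V) (v : V) : contragredient V g φ v = φ (g⁻¹ v) := rfl

end Contragredient

namespace Apartment

variable {Y : Type*} [AddCommGroup Y]

theorem ofCochar_add (y z : Y) : ofCochar (y + z) = ofCochar y + ofCochar z :=
  TensorProduct.tmul_add _ _ _

/-- The embedding of the cocharacters into the apartment, as a linear map. -/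
noncomputable def ofCocharₗ : Y →ₗ[ℤ] Apartment Y :=
  (AddMonoidHom.mk' ofCochar ofCochar_add).toIntLinearMap

end Apartment

/-! ### Real roots and coroots in the apartment. -/

namespace RootGeneratingSystem

variable {I X Y : Type*} [AddCommGroup X] [Module.Free ℤ X] [Module.Finite ℤ X]
  [AddCommGroup Y] [Module.Free ℤ Y] [Module.Finite ℤ Y] (S : RootGeneratingSystem I X Y)

/-- The simple coroots as vectors of the apartment. -/
noncomputable def coroot (i : I) : Apartment Y := Apartment.ofCochar (S.simpleCoroot i)

/-- The simple roots as linear forms on the apartment. -/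
noncomputable def root (i : I) : Module.Dual ℝ (Apartment Y) := S.form (S.simpleRoot i)

theorem form_ofCochar (χ : X) (y : Y) : S.form χ (Apartment.ofCochar y) = (S.pairing χ y : ℝ) := by
  simp [form, Apartment.ofCochar, Module.Dual.baseChange_apply_tmul]

theorem form_add (χ χ' : X) : S.form (χ + χ') = S.form χ + S.form χ' := by
  simp [form]

/-- The linear forms defined by characters, as a linear map. -/
noncomputable def formₗ : X →ₗ[ℤ] Module.Dual ℝ (Apartment Y) :=
  (AddMonoidHom.mk' S.form S.form_add).toIntLinearMap

theorem ker_formₗ : LinearMap.ker S.formₗ = ⊥ := by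
  rw [LinearMap.ker_eq_bot']
  intro χ h
  apply S.perfect.bijective_left.1
  ext y
  have := LinearMap.congr_fun h (Apartment.ofCochar y)
  change S.form χ _ = 0 at this
  rw [form_ofCochar] at this
  simpa using this

include S in
theorem ker_ofCocharₗ : LinearMap.ker (Apartment.ofCocharₗ (Y := Y)) = ⊥ := by
  rw [LinearMap.ker_eq_bot']
  intro y h
  apply S.perfect.bijective_right.1
  ext χ
  have := congrArg (S.form χ) h
  change S.form χ (Apartment.ofCochar y) = _ at this
  rw [form_ofCochar] at this
  simpa using this

variable {S} in
theorem IsFree.linearIndependent_root (hS : S.IsFree) : LinearIndependent ℤ S.root :=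
  hS.1.map' S.formₗ S.ker_formₗ

variable {S} in
theorem IsFree.linearIndependent_coroot (hS : S.IsFree) : LinearIndependent ℤ S.coroot :=
  hS.2.map' Apartment.ofCocharₗ S.ker_ofCocharₗ

theorem root_coroot (i j : I) : S.root i (S.coroot j) = (S.cartan j i : ℝ) := by
  rw [root, coroot, form_ofCochar, S.compat]

theorem simpleReflection_apply (i : I) (v : Apartment Y) :
    S.simpleReflection i v = v - S.root i v • S.coroot i := by
  rw [simpleReflection, Module.reflection_apply]
  rfl

theorem simpleReflection_mul_self (i : I) : S.simpleReflection i * S.simpleReflection i = 1 := by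
  ext v
  exact Module.involutive_reflection (S.form_simpleRoot_simpleCoroot i) v

theorem simpleReflection_inv (i : I) : (S.simpleReflection i)⁻¹ = S.simpleReflection i :=
  inv_eq_of_mul_eq_one_left (S.simpleReflection_mul_self i)

/-- The determinant is the sign character that controls the parity of word lengths. -/
theorem det_simpleReflection (i : I) : LinearEquiv.det (S.simpleReflection i) = -1 := by
  ext
  have : (S.simpleReflection i : Apartment Y →ₗ[ℝ] Apartment Y) =
      LinearMap.transvection (-S.root i) (S.coroot i) := by
    ext v
    simp [LinearMap.transvection, simpleReflection_apply, sub_eq_add_neg]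
  rw [LinearEquiv.coe_det, this, LinearMap.transvection.det]
  simp [root_coroot, S.cartan_diag]
  norm_num

theorem simpleReflection_add_left (i j : I) (v : Apartment Y) (x y : ℝ) :
    S.simpleReflection i (v + x • S.coroot i + y • S.coroot j) =
      v + (-x - S.root i v - S.cartan j i * y) • S.coroot i + y • S.coroot j := by
  simp only [simpleReflection_apply, map_add, map_smul, root_coroot, S.cartan_diag]
  push_cast
  module

theorem simpleReflection_add_right (i j : I) (v : Apartment Y) (x y : ℝ) :
    S.simpleReflection j (v + x • S.coroot i + y • S.coroot j) =
      v + x • S.coroot i + (-y - S.root j v - S.cartan i j * x) • S.coroot j := by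
  simp only [simpleReflection_apply, map_add, map_smul, root_coroot, S.cartan_diag]
  push_cast
  module

theorem braid {i j : I} (hij : i ≠ j) {m : ℕ} (hm : IsBraidLength (S.cartan j i * S.cartan i j) m) :
    wordProd S.simpleReflection (altWord i j m) = wordProd S.simpleReflection (altWord j i m) := by
  have h1 := S.cartan_nonpos i j hij
  have h2 := S.cartan_nonpos j i hij.symm
  refine LinearEquiv.ext fun v => ?_
  -- The added zero terms put `v` in the shape preserved by both reflections, so each braid relation
  -- becomes a comparison of two coefficients.
  obtain ⟨v', hv'⟩ : ∃ v', v' = v + (0 : ℝ) • S.coroot i + (0 : ℝ) • S.coroot j := ⟨_, rfl⟩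
  have hvv : v = v' := by simp [hv']
  rw [show wordProd S.simpleReflection (altWord i j m) v =
    wordProd S.simpleReflection (altWord i j m) v' by rw [← hvv],
    show wordProd S.simpleReflection (altWord j i m) v =
    wordProd S.simpleReflection (altWord j i m) v' by rw [← hvv], hv']
  clear hvv hv' v'
  have key : ∀ p q : ℤ, S.cartan j i = p → S.cartan i j = q → (p = 0 ∧ q = 0 ∧ m = 2) ∨
      (p = -1 ∧ q = -1 ∧ m = 3) ∨ (p = -1 ∧ q = -2 ∧ m = 4) ∨ (p = -2 ∧ q = -1 ∧ m = 4) ∨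
      (p = -1 ∧ q = -3 ∧ m = 6) ∨ (p = -3 ∧ q = -1 ∧ m = 6) →
      wordProd S.simpleReflection (altWord i j m)
        (v + (0 : ℝ) • S.coroot i + (0 : ℝ) • S.coroot j) =
      wordProd S.simpleReflection (altWord j i m)
        (v + (0 : ℝ) • S.coroot i + (0 : ℝ) • S.coroot j) := by
    intro p q hp hq h
    rcases h with h | h | h | h | h | h
    all_goals
      obtain ⟨rfl, rfl, rfl⟩ := h
      simp only [altWord_succ, altWord_zero, wordProd_append, wordProd_cons, wordProd_nil,
        LinearEquiv.mul_apply, one_mul, mul_one, simpleReflection_add_left,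
        simpleReflection_add_right, hp, hq]
      push_cast
      module
  refine key _ _ rfl rfl ?_
  have h0 := S.cartan_zero_iff i j
  generalize S.cartan i j = q at *
  generalize S.cartan j i = p at *
  rcases hm with ⟨h, rfl⟩ | ⟨h, rfl⟩ | ⟨h, rfl⟩ | ⟨h, rfl⟩
  · rcases mul_eq_zero.1 h with h | h <;> simp_all
  all_goals
    have hp : p ≠ 0 := by rintro rfl; simp at h
    have hp' : p ≤ -1 := by omega
    have hq' : q ≤ -1 := by have := mt h0.1 hp; omega
    have h3 : -3 ≤ p := by nlinarith
    have h4 : -3 ≤ q := by nlinarith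
    interval_cases p <;> interval_cases q <;> simp_all

/-- The monoid generated by the simple coroots. -/
def corootCone : AddSubmonoid (Apartment Y) := AddSubmonoid.closure (Set.range S.coroot)

/-- The monoid generated by the simple roots. -/
def rootCone : AddSubmonoid (Module.Dual ℝ (Apartment Y)) :=
  AddSubmonoid.closure (Set.range S.root)

/-- The abstract positivity is applied to `V` with the transposed matrix here, and to the dual with
the matrix itself for roots. The same reduced word serves both, hence equal signs. -/
theorem coroot_positivity {l : List I} {i : I} (h : IsReducedWord S.simpleReflection (l ++ [i])) :
    wordProd S.simpleReflection l (S.coroot i) ∈ S.corootCone :=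
  IsReducedWord.map_simple_mem (s := S.simpleReflection) S.simpleReflection_mul_self
    (ε := LinearEquiv.det) S.det_simpleReflection (A := fun i j => S.cartan j i) S.cartan_diag
    (fun i j hij => S.cartan_nonpos j i hij.symm) (fun _ _ hij _ hm => S.braid hij hm)
    (ρ := LinearEquiv.automorphismGroup.toLinearMapMonoidHom) (f := S.root)
    S.simpleReflection_apply S.root_coroot _ le_rfl h

theorem root_positivity {l : List I} {i : I} (h : IsReducedWord S.simpleReflection (l ++ [i])) :
    contragredient _ (wordProd S.simpleReflection l) (S.root i) ∈ S.rootCone :=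
  IsReducedWord.map_simple_mem (s := S.simpleReflection) S.simpleReflection_mul_self
    (ε := LinearEquiv.det) S.det_simpleReflection (A := S.cartan) S.cartan_diag
    S.cartan_nonpos (fun _ _ hij _ hm => S.braid hij (by rwa [mul_comm]))
    (f := fun i => Module.Dual.eval ℝ _ (S.coroot i))
    (fun i φ => by
      refine LinearMap.ext fun v => ?_
      simp [simpleReflection_inv, simpleReflection_apply, mul_comm])
    (fun i j => S.root_coroot j i) _ le_rfl h

theorem sub_mem_corootCone {w : Apartment Y ≃ₗ[ℝ] Apartment Y} (hw : w ∈ S.weylGroup) {lam : Y}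
    (hlam : lam ∈ S.dominantCoweights) :
    Apartment.ofCochar lam - w (Apartment.ofCochar lam) ∈ S.corootCone := by
  obtain ⟨l₀, rfl⟩ := exists_wordProd_eq S.simpleReflection_mul_self hw
  obtain ⟨l, hl, hp, -⟩ := exists_isReducedWord S.simpleReflection l₀
  rw [← hp]
  refine IsReducedWord.sub_map_mem (s := S.simpleReflection) S.simpleReflection_mul_self
    (ε := LinearEquiv.det) S.det_simpleReflection (A := fun i j => S.cartan j i) S.cartan_diag
    (fun i j hij => S.cartan_nonpos j i hij.symm) (fun _ _ hij _ hm => S.braid hij hm)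
    (ρ := LinearEquiv.automorphismGroup.toLinearMapMonoidHom) (f := S.root)
    S.simpleReflection_apply S.root_coroot hl fun i => ?_
  obtain ⟨n, hn⟩ := Int.eq_ofNat_of_zero_le (hlam i)
  exact ⟨n, by rw [root, form_ofCochar, hn]; simp⟩

/-- `(φ, c)` is a real root together with its coroot. -/
def IsRootPair (φ : Module.Dual ℝ (Apartment Y)) (c : Apartment Y) : Prop :=
  ∃ w ∈ S.weylGroup, ∃ i, φ = contragredient _ w (S.root i) ∧ c = w (S.coroot i)

variable {S} {φ ψ χ : Module.Dual ℝ (Apartment Y)} {c : Apartment Y}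

theorem IsRootPair.apply_eq_two (h : S.IsRootPair φ c) : φ c = 2 := by
  obtain ⟨w, -, i, rfl, rfl⟩ := h
  rw [contragredient_apply, ← LinearEquiv.mul_apply, inv_mul_cancel, LinearEquiv.coe_one, id,
    root_coroot, S.cartan_diag]
  norm_num

theorem IsRootPair.map (h : S.IsRootPair φ c) {g : Apartment Y ≃ₗ[ℝ] Apartment Y}
    (hg : g ∈ S.weylGroup) : S.IsRootPair (contragredient _ g φ) (g c) := by
  obtain ⟨w, hw, i, rfl, rfl⟩ := h
  exact ⟨g * w, mul_mem hg hw, i, by simp [map_mul], rfl⟩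

theorem mem_weylGroup_simpleReflection (i : I) : S.simpleReflection i ∈ S.weylGroup :=
  Subgroup.subset_closure ⟨i, rfl⟩

theorem conj_simpleReflection_apply (w : Apartment Y ≃ₗ[ℝ] Apartment Y) (i : I)
    (v : Apartment Y) : (w * S.simpleReflection i * w⁻¹) v =
      v - contragredient _ w (S.root i) v • w (S.coroot i) := by
  simp only [LinearEquiv.mul_apply, simpleReflection_apply, map_sub, map_smul,
    contragredient_apply]
  rw [← LinearEquiv.mul_apply, mul_inv_cancel]
  rfl

theorem IsRootPair.exists_reflection (h : S.IsRootPair φ c) :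
    ∃ r ∈ S.weylGroup, ∀ v, r v = v - φ v • c := by
  obtain ⟨w, hw, i, rfl, rfl⟩ := h
  exact ⟨_, mul_mem (mul_mem hw (mem_weylGroup_simpleReflection i)) (inv_mem hw),
    conj_simpleReflection_apply w i⟩

/-- A real root and its coroot have the same sign. -/
theorem IsRootPair.pos_or_neg (h : S.IsRootPair φ c) :
    (φ ∈ S.rootCone ∧ c ∈ S.corootCone) ∨ (-φ ∈ S.rootCone ∧ -c ∈ S.corootCone) := by
  obtain ⟨w, hw, i, rfl, rfl⟩ := h
  obtain ⟨l, hl, rfl | rfl⟩ :=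
    exists_isReducedWord_append S.simpleReflection_mul_self S.det_simpleReflection hw i
  · exact Or.inl ⟨S.root_positivity hl, S.coroot_positivity hl⟩
  · have h1 : S.simpleReflection i (S.coroot i) = -S.coroot i := by
      rw [simpleReflection_apply, root_coroot, S.cartan_diag]
      push_cast
      module
    have h2 : contragredient _ (S.simpleReflection i) (S.root i) = -S.root i := by
      refine LinearMap.ext fun v => ?_
      simp [simpleReflection_inv, simpleReflection_apply, root_coroot, S.cartan_diag]
      ring
    refine Or.inr ⟨?_, ?_⟩
    · rw [map_mul, Module.End.mul_apply, h2, map_neg, neg_neg]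
      exact S.root_positivity hl
    · rw [LinearEquiv.mul_apply, h1, map_neg, neg_neg]
      exact S.coroot_positivity hl

variable (hS : S.IsFree)

theorem eq_zero_of_mem_of_neg_mem {ι M : Type*} [AddCommGroup M] [Module ℝ M] {a : ι → M}
    (ha : LinearIndependent ℤ a) {p : M} (hp : p ∈ AddSubmonoid.closure (Set.range a))
    (hn : -p ∈ AddSubmonoid.closure (Set.range a)) : p = 0 := by
  obtain ⟨ht, h⟩ := ha.exists_height
  by_contra h0
  have h1 := one_le_height h hp h0
  have h2 := height_nonneg h hn
  rw [map_neg] at h2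
  linarith

include hS in
theorem IsRootPair.mem_rootCone (h : S.IsRootPair φ c) (hc : c ∈ S.corootCone) :
    φ ∈ S.rootCone := by
  rcases h.pos_or_neg with h' | h'
  · exact h'.1
  · have := eq_zero_of_mem_of_neg_mem hS.linearIndependent_coroot hc h'.2
    have h2 := h.apply_eq_two
    simp [this] at h2

include hS in
theorem IsRootPair.mem_corootCone (h : S.IsRootPair φ c) (hφ : φ ∈ S.rootCone) :
    c ∈ S.corootCone := by
  rcases h.pos_or_neg with h' | h'
  · exact h'.2
  · have := eq_zero_of_mem_of_neg_mem hS.linearIndependent_root hφ h'.1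
    have h2 := h.apply_eq_two
    simp [this] at h2

/-- The product of the two reflections fixes `c` and acts on forms by `χ ↦ χ + χ(c)(ψ - φ)`. Since
`χ(c) = 2` for every root with coroot `c`, each application adds `2(ψ - φ)`. -/
theorem IsRootPair.add_smul_sub (hφ : S.IsRootPair φ c) (hψ : S.IsRootPair ψ c) (n : ℕ) :
    S.IsRootPair (ψ + n • (2 : ℝ) • (ψ - φ)) c := by
  induction n with
  | zero => simpa using hψ
  | succ n ih =>
    obtain ⟨r, hr, hrv⟩ := hφ.exists_reflection
    obtain ⟨t, ht, htv⟩ := hψ.exists_reflection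
    have h1 := hφ.apply_eq_two
    have h2 := hψ.apply_eq_two
    have hc : (t * r) c = c := by
      simp only [LinearEquiv.mul_apply, hrv, htv, map_sub, map_smul, h1, h2, smul_eq_mul]
      module
    have h3 := ih.map (mul_mem ht hr)
    rw [hc] at h3
    convert h3 using 1
    have : ∀ v, (t * r)⁻¹ v = v - φ v • c + ψ v • c := by
      intro v
      apply (t * r).injective
      rw [← LinearEquiv.mul_apply (t * r) (t * r)⁻¹, mul_inv_cancel]
      simp only [LinearEquiv.mul_apply, hrv, htv, map_sub, map_add, map_smul, h1, h2, smul_eq_mul,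
        LinearEquiv.coe_one, id]
      module
    refine LinearMap.ext fun v => ?_
    simp only [contragredient_apply, this, LinearMap.add_apply, LinearMap.smul_apply,
      LinearMap.sub_apply, map_add, map_sub, map_smul, h1, h2, smul_eq_mul, nsmul_eq_mul]
    push_cast
    ring

include hS in
/-- A real root is determined by its coroot. -/
theorem IsRootPair.unique [Finite I] (hφ : S.IsRootPair φ c) (hψ : S.IsRootPair ψ c)
    (hc : c ∈ S.corootCone) : φ = ψ := by
  obtain ⟨ht, h⟩ := hS.linearIndependent_root.exists_height
  -- All `ψ + 2n(ψ - φ)` are positive, so their heights cannot decrease; by symmetry `ψ - φ` has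
  -- height 0. If it were nonzero, infinitely many positive elements would share one height.
  have key : ∀ {φ ψ}, S.IsRootPair φ c → S.IsRootPair ψ c → 0 ≤ ht ((2 : ℝ) • (ψ - φ)) := by
    intro φ ψ hφ hψ
    by_contra! hneg
    obtain ⟨n, hn⟩ := exists_nat_gt (ht ψ / -ht ((2 : ℝ) • (ψ - φ)))
    rw [div_lt_iff₀ (by linarith)] at hn
    have := height_nonneg h ((hφ.add_smul_sub hψ n).mem_rootCone hS hc)
    rw [map_add, map_nsmul, nsmul_eq_mul] at this
    linarith
  have h0 : ht ((2 : ℝ) • (ψ - φ)) = 0 := by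
    refine le_antisymm ?_ (key hφ hψ)
    have := key hψ hφ
    rw [← neg_sub, smul_neg, map_neg] at this
    linarith
  by_contra hne
  have hinj : Function.Injective fun n : ℕ => ψ + n • (2 : ℝ) • (ψ - φ) := by
    intro m n hmn
    have h1 : (2 : ℝ) • (ψ - φ) ≠ 0 := smul_ne_zero two_ne_zero (sub_ne_zero.2 (Ne.symm hne))
    have h2 := add_left_cancel hmn
    rw [← Nat.cast_smul_eq_nsmul ℝ, ← Nat.cast_smul_eq_nsmul ℝ n] at h2
    exact_mod_cast smul_left_injective ℝ h1 h2
  refine Set.infinite_of_injective_forall_mem hinj (fun n => ?_) (finite_height_le h (ht ψ))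
  refine ⟨(hφ.add_smul_sub hψ n).mem_rootCone hS hc, ?_⟩
  rw [map_add, map_nsmul, h0]
  simp

theorem form_mem_rootCone {β : X} (h : β ∈ AddSubmonoid.closure (Set.range S.simpleRoot)) :
    S.form β ∈ S.rootCone := by
  induction h using AddSubmonoid.closure_induction with
  | mem x hx => obtain ⟨i, rfl⟩ := hx; exact AddSubmonoid.subset_closure ⟨i, rfl⟩
  | zero => rw [show S.form 0 = 0 from map_zero S.formₗ]; exact zero_mem _
  | add x y _ _ hx hy => rw [form_add]; exact add_mem hx hy

include hS in
theorem exists_positive_coroot {β : X} (hβ : β ∈ S.posRealRoots)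
    {r : Apartment Y ≃ₗ[ℝ] Apartment Y} (hr : S.IsReflectionOf β r) :
    ∃ c ∈ S.corootCone, S.IsRootPair (S.form β) c ∧ ∀ v, r v = v - S.form β v • c := by
  obtain ⟨w, hw, i, hi, rfl⟩ := hr
  have h1 : S.form β = contragredient _ w (S.root i) := by
    refine LinearMap.ext fun v => ?_
    have := hi (w⁻¹ v)
    rw [← LinearEquiv.mul_apply, mul_inv_cancel] at this
    exact this
  have h2 : S.IsRootPair (S.form β) (w (S.coroot i)) := ⟨w, hw, i, h1, rfl⟩
  exact ⟨_, h2.mem_corootCone hS (form_mem_rootCone hβ.2), h2, fun v => by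
    rw [conj_simpleReflection_apply, h1]⟩

end RootGeneratingSystem

/-! ### One-sided velocities of piecewise linear paths. -/

section Velocities

variable {V : Type*} [AddCommGroup V] [Module ℝ V] {π : Set.Icc (0 : ℝ) 1 → V}
  {t b : Set.Icc (0 : ℝ) 1} {ξ ξ' : V}

theorem HasLeftVelocity.eq_of_affine (h : HasLeftVelocity π t ξ) (hb : b < t)
    (hπ : ∀ s, b ≤ s → s ≤ t → π s = π b + ((s : ℝ) - b) • ξ') : ξ = ξ' := by
  obtain ⟨ε, hε, h⟩ := h
  have hb' : (b : ℝ) < t := hb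
  have ht := t.2
  obtain ⟨s, hs⟩ : ∃ s : Set.Icc (0 : ℝ) 1, (s : ℝ) = max (b : ℝ) (t - ε / 2) :=
    ⟨⟨max (b : ℝ) (t - ε / 2), le_max_of_le_left b.2.1, max_le b.2.2 (by linarith [ht.2])⟩, rfl⟩
  have hbs : (b : ℝ) ≤ s := hs ▸ le_max_left _ _
  have hst : (s : ℝ) < t := hs ▸ max_lt hb' (by linarith)
  have h1 := h s (by have := le_max_right (b : ℝ) (t - ε / 2); linarith) hst.le
  have h2 := hπ s hbs hst.le
  have h3 := hπ t hb.le le_rfl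
  have h4 : ((s : ℝ) - t) • ξ = ((s : ℝ) - t) • ξ' := by
    have : ((s : ℝ) - t) • ξ = π s - π t := by rw [h1]; abel
    rw [this, h2, h3]
    module
  exact smul_right_injective V (sub_ne_zero.2 hst.ne) h4

theorem HasRightVelocity.eq_of_affine (h : HasRightVelocity π t ξ) (hb : t < b)
    (hπ : ∀ s, t ≤ s → s ≤ b → π s = π t + ((s : ℝ) - t) • ξ') : ξ = ξ' := by
  obtain ⟨ε, hε, h⟩ := h
  have hb' : (t : ℝ) < b := hb
  have ht := t.2
  obtain ⟨s, hs⟩ : ∃ s : Set.Icc (0 : ℝ) 1, (s : ℝ) = min (b : ℝ) (t + ε / 2) :=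
    ⟨⟨min (b : ℝ) (t + ε / 2), le_min b.2.1 (by linarith [ht.1]), min_le_of_left_le b.2.2⟩, rfl⟩
  have hbs : (s : ℝ) ≤ b := hs ▸ min_le_left _ _
  have hst : (t : ℝ) < s := hs ▸ lt_min hb' (by linarith)
  have h1 := h s hst.le (by have := min_le_right (b : ℝ) (t + ε / 2); linarith)
  have h2 := hπ s hst.le hbs
  exact smul_right_injective V (sub_ne_zero.2 hst.ne') (add_left_cancel (h1.symm.trans h2))

end Velocities

/-! ### Fold traces of Hecke paths and their finiteness. -/

namespace RootGeneratingSystem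

variable {I X Y : Type*} [AddCommGroup X] [Module.Free ℤ X] [Module.Finite ℤ X]
  [AddCommGroup Y] [Module.Free ℤ Y] [Module.Finite ℤ Y] (S : RootGeneratingSystem I X Y)

/-- `S.FoldTrace ξ h` says that a finite sequence of positive foldings, at positive times `τ` such
that `τ β(ξ)` is integral, ends with velocity `ξ` and that `h` is the sum of the corrections
`s ↦ (τ - s)⁺ (r_β(ξ) - ξ)` by which the folded path differs from a straight one. -/
inductive FoldTrace : Apartment Y → (ℝ → Apartment Y) → Prop
  | straight (ξ : Apartment Y) : FoldTrace ξ 0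
  | fold {ξ : Apartment Y} {h : ℝ → Apartment Y} {β : X} {r : Apartment Y ≃ₗ[ℝ] Apartment Y}
      {τ : ℝ} : FoldTrace ξ h → β ∈ S.posRealRoots → S.IsReflectionOf β r → S.form β ξ < 0 →
      0 < τ → (∃ k : ℤ, τ * S.form β ξ = k) →
      FoldTrace (r ξ) fun s => h s + max (τ - s) 0 • (r ξ - ξ)

variable {S} (hS : S.IsFree)

include hS in
/-- A folding changes the velocity by a positive multiple of a positive coroot. -/
theorem exists_fold_coroot {ξ : Apartment Y} {β : X} {r : Apartment Y ≃ₗ[ℝ] Apartment Y} {τ : ℝ}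
    (hβ : β ∈ S.posRealRoots) (hr : S.IsReflectionOf β r) (hneg : S.form β ξ < 0) (hτ : 0 < τ)
    (hk : ∃ k : ℤ, τ * S.form β ξ = k) :
    ∃ c ∈ S.corootCone, S.IsRootPair (S.form β) c ∧ ξ = r ξ - S.form β (r ξ) • c ∧
      r ξ - ξ = S.form β (r ξ) • c ∧ 0 < S.form β (r ξ) ∧
      ∃ m : ℕ, 0 < m ∧ τ • (r ξ - ξ) = m • c := by
  obtain ⟨c, hc, hp, hrv⟩ := exists_positive_coroot hS hβ hr
  have h1 : S.form β (r ξ) = -S.form β ξ := by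
    rw [hrv, map_sub, map_smul, hp.apply_eq_two, smul_eq_mul]
    ring
  refine ⟨c, hc, hp, ?_, ?_, by linarith, ?_⟩
  · rw [h1, hrv]; module
  · rw [h1, hrv]; module
  · obtain ⟨k, hk⟩ := hk
    -- The multiplicity is `m = -k`; strict negativity of `k` makes it at least 1, so every fold
    -- costs height.
    have hk0 : k < 0 := by
      have := mul_neg_of_pos_of_neg hτ hneg
      rw [hk] at this
      exact_mod_cast this
    obtain ⟨m, hm⟩ := Int.eq_ofNat_of_zero_le (show 0 ≤ -k by omega)
    refine ⟨m, by omega, ?_⟩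
    have h2 : (m : ℝ) = -(τ * S.form β ξ) := by
      rw [hk]
      exact_mod_cast hm.symm
    rw [← Nat.cast_smul_eq_nsmul ℝ, h2, hrv]
    module

include hS in
theorem FoldTrace.apply_zero_mem {ξ : Apartment Y} {h : ℝ → Apartment Y}
    (hh : S.FoldTrace ξ h) : h 0 ∈ S.corootCone := by
  induction hh with
  | straight => exact zero_mem _
  | fold hh hβ hr hneg hτ hk ih =>
    obtain ⟨c, hc, -, -, -, -, m, -, hm⟩ := exists_fold_coroot hS hβ hr hneg hτ hk
    simp only [sub_zero, max_eq_left hτ.le, hm]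
    exact add_mem ih (nsmul_mem hc m)

include hS in
/-- There are only finitely many fold traces of bounded height with given final velocity. -/
theorem finite_foldTrace [Finite I] {ht : Apartment Y →+ ℚ} (hht : ∀ i, ht (S.coroot i) = 1)
    (n : ℕ) : ∀ ξ, {h | S.FoldTrace ξ h ∧ ht (h 0) < n}.Finite := by
  induction n with
  | zero =>
    intro ξ
    convert Set.finite_empty
    ext h
    simp only [Set.mem_ofPred_eq, Set.mem_empty_iff_false, iff_false, not_and, not_lt]
    intro hh
    simpa using height_nonneg hht (hh.apply_zero_mem hS)
  | succ n ih =>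
    intro ξ
    let B := {p | p ∈ S.corootCone ∧ ht p ≤ n + 1}
    have hB : B.Finite := finite_height_le hht _
    -- The last fold is recorded by its coroot `c` and its contribution `q` to `h 0`. Then `c`
    -- determines `φ`, and `q = τ φ(ξ) c` determines `τ`. As reflections are involutions, the
    -- velocity before the fold is `ξ - φ(ξ) c`.
    let Q : Apartment Y → Apartment Y → Module.Dual ℝ (Apartment Y) → ℝ → Prop := fun q c φ τ =>
      S.IsRootPair φ c ∧ 0 < φ ξ ∧ q = τ • (φ ξ • c)
    let T : Apartment Y → Apartment Y → Set (ℝ → Apartment Y) := fun q c =>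
      {h | ∃ φ τ h', Q q c φ τ ∧ S.FoldTrace (ξ - φ ξ • c) h' ∧ ht (h' 0) < n ∧
        h = fun s => h' s + max (τ - s) 0 • (φ ξ • c)}
    have hT : ∀ q, ∀ c ∈ B, (T q c).Finite := by
      intro q c hc
      by_cases hex : ∃ φ τ, Q q c φ τ
      · obtain ⟨φ, τ, hφ, hpos, hq⟩ := hex
        refine ((ih (ξ - φ ξ • c)).image
          fun h' s => h' s + max (τ - s) 0 • (φ ξ • c)).subset ?_
        rintro _ ⟨φ', τ', h', ⟨hφ', -, hq'⟩, hh', hlt, rfl⟩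
        obtain rfl := hφ.unique hS hφ' hc.1
        have hc0 : c ≠ 0 := by
          rintro rfl
          simpa using hφ.apply_eq_two
        obtain rfl : τ' = τ :=
          smul_left_injective ℝ (smul_ne_zero hpos.ne' hc0) (hq'.symm.trans hq)
        exact ⟨h', ⟨hh', hlt⟩, rfl⟩
      · convert Set.finite_empty
        ext h
        simp only [Set.mem_empty_iff_false, iff_false]
        rintro ⟨φ, τ, h', hQ, -⟩
        exact hex ⟨φ, τ, hQ⟩
    refine ((Set.finite_singleton 0).union
      (hB.biUnion fun q _ => hB.biUnion fun c hc => hT q c hc)).subset ?_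
    rintro h ⟨hh, hlt⟩
    cases hh with
    | straight => exact Or.inl rfl
    | @fold ξ' h' β r τ hh' hβ hr hneg hτ hk =>
      right
      obtain ⟨c, hc, hp, h1, h2, h3, m, hm, hmc⟩ := exists_fold_coroot hS hβ hr hneg hτ hk
      simp only [sub_zero, max_eq_left hτ.le, hmc, map_add, map_nsmul, nsmul_eq_mul] at hlt
      have hc0 : c ≠ 0 := by
        rintro rfl
        simpa using hp.apply_eq_two
      have hc1 := one_le_height hht hc hc0
      have hm1 : (1 : ℚ) ≤ m := by exact_mod_cast hm
      have h0 := height_nonneg hht (hh'.apply_zero_mem hS)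
      push_cast at hlt
      simp only [Set.mem_iUnion]
      refine ⟨m • c, ⟨nsmul_mem hc m, ?_⟩, c, ⟨hc, by nlinarith⟩,
        S.form β, τ, h', ⟨hp, h3, by rw [← hmc, h2]⟩, h1 ▸ hh', by nlinarith, by rw [h2]⟩
      rw [map_nsmul, nsmul_eq_mul]
      linarith

/-- Up to time `a`, the path `π` issued from `y` is the folded path given by the fold trace `h`
with velocity `ξ` at `a`. -/
def IsTracedUpTo (S : RootGeneratingSystem I X Y) (y : Y) (π : Set.Icc (0 : ℝ) 1 → Apartment Y)
    (a : Set.Icc (0 : ℝ) 1) (ξ : Apartment Y) (h : ℝ → Apartment Y) : Prop :=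
  S.FoldTrace ξ h ∧ (∀ s, (a : ℝ) ≤ s → h s = 0) ∧
    ∀ s : Set.Icc (0 : ℝ) 1, s ≤ a → π s = Apartment.ofCochar y - h 0 + (s : ℝ) • ξ + h s

theorem exists_ofCochar_of_mem_corootCone {p : Apartment Y} (hp : p ∈ S.corootCone) :
    ∃ y, Apartment.ofCochar y = p := by
  induction hp using AddSubmonoid.closure_induction with
  | mem x hx => obtain ⟨i, rfl⟩ := hx; exact ⟨_, rfl⟩
  | zero => exact ⟨0, map_zero Apartment.ofCocharₗ⟩
  | add x y _ _ hx hy =>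
    obtain ⟨u, rfl⟩ := hx
    obtain ⟨v, rfl⟩ := hy
    exact ⟨u + v, Apartment.ofCochar_add u v⟩

variable {y : Y} {π : Set.Icc (0 : ℝ) 1 → Apartment Y} {a b : Set.Icc (0 : ℝ) 1}
  {ξ ξ' : Apartment Y} {h : ℝ → Apartment Y}

/-- The correction `h` vanishes from `a` onwards, so the same formula continues straight with
velocity `ξ`. -/
theorem IsTracedUpTo.extend (hh : S.IsTracedUpTo y π a ξ h) (hab : a ≤ b)
    (hπ : ∀ s, a ≤ s → s ≤ b → π s = π a + ((s : ℝ) - a) • ξ) : S.IsTracedUpTo y π b ξ h := by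
  obtain ⟨h1, h2, h3⟩ := hh
  refine ⟨h1, fun s hs => h2 s (le_trans (show (a : ℝ) ≤ b from hab) hs), fun s hs => ?_⟩
  rcases le_total s a with hsa | hsa
  · exact h3 s hsa
  · rw [hπ s hsa hs, h3 a le_rfl, h2 a le_rfl, h2 s hsa]
    module

-- For `s ≤ a` the added terms `-a`, `s` and `(a - s)⁺`, all times `r ξ - ξ`, cancel: a fold at time
-- `a` does not alter the path before `a`.
include hS in
theorem IsTracedUpTo.chainStep (ha : 0 < a) (hh : S.IsTracedUpTo y π a ξ h)
    (hstep : S.ChainStep (π a) ξ ξ') : ∃ h', S.IsTracedUpTo y π a ξ' h' := by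
  obtain ⟨h1, h2, h3⟩ := hh
  obtain ⟨β, hβ, ⟨r, hr, rfl⟩, hneg, k, hk⟩ := hstep
  have ha' : 0 < (a : ℝ) := ha
  obtain ⟨z, hz⟩ := exists_ofCochar_of_mem_corootCone (h1.apply_zero_mem hS)
  -- From `k = β(π(a)) = β(y) - β(h(0)) + a β(ξ)` with `h(0) = z` a cocharacter.
  refine ⟨_, h1.fold hβ hr hneg ha' ⟨k - S.pairing β y + S.pairing β z, ?_⟩, ?_, ?_⟩
  · rw [h3 a le_rfl, h2 a le_rfl, ← hz] at hk
    simp only [map_add, map_sub, map_smul, form_ofCochar, smul_eq_mul, map_zero] at hk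
    push_cast
    linarith
  · intro s hs
    simp [h2 s hs, max_eq_right (sub_nonpos.2 hs)]
  · intro s hs
    have hs' : (s : ℝ) ≤ a := hs
    simp only [h3 s hs, sub_zero, max_eq_left ha'.le, max_eq_left (sub_nonneg.2 hs')]
    module

include hS in
theorem IsTracedUpTo.chain (ha : 0 < a) (hh : S.IsTracedUpTo y π a ξ h)
    (hchain : Relation.ReflTransGen (S.ChainStep (π a)) ξ ξ') :
    ∃ h', S.IsTracedUpTo y π a ξ' h' := by
  induction hchain with
  | refl => exact ⟨h, hh⟩
  | tail _ hstep ih =>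
    obtain ⟨h', hh'⟩ := ih
    exact hh'.chainStep hS ha hstep

include hS in
theorem IsHeckePath.exists_trace {lam : Y} (hπ : S.IsHeckePath lam π)
    (h0 : π 0 = Apartment.ofCochar y) :
    ∃ ξ ∈ S.weylOrbit (Apartment.ofCochar lam), ∃ h, S.IsTracedUpTo y π 1 ξ h := by
  obtain ⟨⟨n, a, ξ, hmono, ha0, ha1, hseg⟩, hchain⟩ := hπ
  have key : ∀ j, ∀ hj : j < n, ∃ h, S.IsTracedUpTo y π (a (Fin.succ ⟨j, hj⟩)) (ξ ⟨j, hj⟩) h := by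
    intro j
    induction j with
    | zero =>
      intro hj
      have hz : (Fin.castSucc (⟨0, hj⟩ : Fin n)) = 0 := rfl
      refine ⟨0, IsTracedUpTo.extend (a := a (Fin.castSucc ⟨0, hj⟩)) ?_
        (hmono (Fin.castSucc_lt_succ)).le (hseg ⟨0, hj⟩).2⟩
      rw [hz, ha0]
      refine ⟨.straight _, fun _ _ => rfl, fun s hs => ?_⟩
      obtain rfl : s = 0 := le_antisymm hs s.2.1
      simp [h0]
    | succ j ih =>
      intro hj
      have hj' : j < n := by omega
      obtain ⟨h, hh⟩ := ih hj'
      set t := a (Fin.succ ⟨j, hj'⟩) with ht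
      have ht' : t = a (Fin.castSucc ⟨j + 1, hj⟩) := rfl
      have hlt0 : a (Fin.castSucc ⟨j, hj'⟩) < t := hmono Fin.castSucc_lt_succ
      have hlt1 : t < a (Fin.succ ⟨j + 1, hj⟩) := ht' ▸ hmono Fin.castSucc_lt_succ
      have htpos : 0 < t := lt_of_le_of_lt (a _).2.1 hlt0
      obtain ⟨ξL, ξR, hL, hR, hc⟩ := hchain t htpos (lt_of_lt_of_le hlt1 (a _).2.2)
      -- The one-sided velocities at the breakpoint are those of the adjacent segments, so the chain
      -- leads from one to the next.
      rw [hL.eq_of_affine hlt0 (hseg ⟨j, hj'⟩).2,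
        hR.eq_of_affine hlt1 (hseg ⟨j + 1, hj⟩).2] at hc
      obtain ⟨h', hh'⟩ := hh.chain hS htpos hc
      exact ⟨h', hh'.extend hlt1.le (hseg ⟨j + 1, hj⟩).2⟩
  have hn : 0 < n := by
    rcases Nat.eq_zero_or_pos n with rfl | hn
    · exact absurd (ha0.symm.trans ha1) zero_ne_one
    · exact hn
  obtain ⟨m, rfl⟩ : ∃ m, n = m + 1 := ⟨n - 1, by omega⟩
  obtain ⟨h, hh⟩ := key m (by omega)
  refine ⟨ξ ⟨m, by omega⟩, (hseg _).1, h, ?_⟩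
  rw [← ha1]
  exact hh

end RootGeneratingSystem

/-! ### Finiteness of Hecke paths with given endpoints. -/

theorem corollary4p5 {I X Y : Type*} [Finite I]
    [AddCommGroup X] [Module.Free ℤ X] [Module.Finite ℤ X]
    [AddCommGroup Y] [Module.Free ℤ Y] [Module.Finite ℤ Y]
    (S : RootGeneratingSystem I X Y) (hS : S.IsFree)
    (y₀ y₁ lam : Y) (hlam : lam ∈ S.dominantCoweights) :
    {π : Set.Icc (0 : ℝ) 1 → Apartment Y | S.IsHeckePath lam π ∧
      π 0 = Apartment.ofCochar y₀ ∧ π 1 = Apartment.ofCochar y₁}.Finite := by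
  obtain ⟨ht, hht⟩ := hS.linearIndependent_coroot.exists_height
  -- The total height to be shared between `p = λ - ξ` and `h 0`; the path is recovered from `p` and
  -- `h`.
  let K := ht (Apartment.ofCochar lam - (Apartment.ofCochar y₁ - Apartment.ofCochar y₀))
  have hB : {p | p ∈ S.corootCone ∧ ht p ≤ K}.Finite :=
    finite_height_le hht K
  refine (hB.biUnion fun p _ =>
    (RootGeneratingSystem.finite_foldTrace hS hht (⌊K⌋₊ + 1) (Apartment.ofCochar lam - p)).image
      fun (h : ℝ → Apartment Y) (s : Set.Icc (0 : ℝ) 1) => Apartment.ofCochar y₀ - h 0 +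
        (s : ℝ) • (Apartment.ofCochar lam - p) + h s).subset ?_
  rintro π ⟨hπ, h0, h1⟩
  obtain ⟨ξ, ⟨w, hw, rfl⟩, h, hh, hz, hs⟩ := hπ.exists_trace hS h0
  have hp := S.sub_mem_corootCone hw hlam
  have hend := hs 1 le_rfl
  rw [hz _ le_rfl, h1] at hend
  have hK : K = ht (Apartment.ofCochar lam - w (Apartment.ofCochar lam)) + ht (h 0) := by
    rw [← map_add]
    simp only [K, hend, Set.Icc.coe_one, one_smul]
    congr 1
    abel
  have h2 := height_nonneg hht hp
  have h3 := height_nonneg hht (hh.apply_zero_mem hS)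
  simp only [Set.mem_iUnion]
  refine ⟨_, ⟨hp, by linarith⟩, h, ⟨by rwa [sub_sub_cancel], ?_⟩, ?_⟩
  · push_cast
    have := Nat.lt_floor_add_one K
    linarith
  · funext s
    rw [sub_sub_cancel]
    exact (hs s s.2.2).symm
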